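/- **Setup.** A server holds files of $F$ bits in $L$ popularity levels; there are $K\ge1$ caches, arranged cyclically. Level $i$ has $N_i\ge1$ files and access degree $1\le d_i\le K$; for each of the $K$ windows of $d_i$ cyclically consecutive caches, exactly $U_i\ge1$ users are connected to precisely these caches, and each of them requests an arbitrary file of level $i$. Let $D=\max_i d_i$ and $\beta=\frac1{198}$. Assume the regularity conditions $N_i\ge KU_i$ for all $i$, and $\sqrt{\frac{U_i/N_i}{U_j/N_j}}\ge D/\beta$ whenever $i\ne j$ and $U_i/N_i\ge U_j/N_j$ (in particular no two levels have the same popularity). A rate $R$ is *achievable* with cache memory $M$ if for every $\varepsilon>0$ and all sufficiently large $F$ there is a strategy (cache placement before the requests are known, a broadcast that depends on the requests, decoders that see the requests, the broadcast and the accessed caches) with caches of at most $MF$ bits and a broadcast of at most $(R+\varepsilon)F$ bits such that, for every combination of requests, the probability over independent uniformly random files that some user fails to recover its file is at most $\varepsilon$. The single-level rate is $$R^{\rm SL}(m,K,N,U,d)=U\min\{N/m,K\}\,(1-dm/N),\qquad \min\{N/0,K\}:=K .$$ For a set $A$ of levels let $S_A=\sum_{i\in A}\sqrt{N_iU_i}$,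 $T_A=\sum_{i\in A}N_i/d_i$, $V_A=\sum_{i\in A}N_i/K$. For $M\ge0$, a partition $(H,I,J)$ of the set of levels is *$M$-feasible* if, with $\tilde M=(M-T_J+V_I)/S_I$, $$\tilde M<\tfrac1K\sqrt{N_h/U_h}\ (h\in H),\qquad \tfrac1K\sqrt{N_i/U_i}\le\tilde M\le\bigl(\tfrac1{d_i}+\tfrac1K\bigr)\sqrt{N_i/U_i}\ (i\in I),\qquad \bigl(\tfrac1{d_j}+\tfrac1K\bigr)\sqrt{N_j/U_j}<\tilde M\ (j\in J);$$ for $I=\emptyset$ this is read with $\tilde M=+\infty$ and $M-T_J>0$, i.e. $H=\emptyset$ and $M>T_J$. Let $I_0=\{i\in I:\tilde M<\frac2K\sqrt{N_i/U_i}\}$, $I_1=\{i\in I:\tilde M>(\frac{\beta}{d_i}+\frac1K)\sqrt{N_i/U_i}\}$, $I'=I\setminus(I_0\cup I_1)$. The memory $\mu_i=\alpha_iM$ given to level $i$ is $\mu_h=0$ for $h\in H$, $\mu_i=\sqrt{N_iU_i}\,\tilde M-N_i/K$ for $i\in I$, and $\mu_j=N_j/d_j$ for $j\in J$; the individual rates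 are $R_i(M)=R^{\rm SL}(\mu_i,K,N_i,U_i,d_i)$. **Theorem.** Let $(H,I,J)$ be an $M$-feasible partition, $M\ge0$. Then: 1. $0\le\mu_i\le N_i/d_i$ for all $i$ and $\sum_i\mu_i\le M$, with equality if $I\neq\emptyset$. 2. For every level $i$, the system that consists of level $i$ alone achieves the rate $R_i(M)$ with cache memory $\mu_i$. 3. The individual rates satisfy - $R_h(M)=KU_h$ for $h\in H$; - $R_i(M)\le\dfrac{2S_I\sqrt{N_iU_i}}{M-T_J+V_I}$ for $i\in I_0\cup I'$; - $R_{i}(M)\le\dfrac1\beta d_{i}U_{i}\Bigl(1-\dfrac{M-T_J}{N_{i}/d_{i}}\Bigr)+\dfrac1\beta d_{i}U_{i}\dfrac{S_{I_0}+S_{I'}}{\sqrt{N_{i}U_{i}}}$ for $i\in I_1$; - $R_j(M)=0$ for $j\in J$. 4. The total rate $R(M)=\sum_{i=1}^LR_i(M)$ satisfies $$R(M)\le\sum_{h\in H}KU_h+\frac{2S_I^2}{M-T_J+V_I}-\sum_{i\in I\setminus I_0}d_iU_i,$$ and, if $I_0=\emptyset$, $$\sum_{h\in H}KU_h+\frac{S_I^2}{M-T_J}-\sum_{i\in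 I}d_iU_i\le R(M)\le\sum_{h\in H}KU_h+\frac{2S_I^2}{M-T_J}-\sum_{i\in I}d_iU_i,$$ where $S_I^2/(M-T_J)$ is read as $0$ if $I=\emptyset$. 5. The rate $R(M)$ is achievable with cache memory $M$ in the whole multi-level system. -/

import Mathlib

noncomputable section

namespace MultiLevelCaching

/-- A multi-user, multi-level, multi-access caching setup with `L` popularity levels and `K` caches.
Level `i` has `N i` files and access degree `d i`. For every window of `d i` cyclically
consecutive caches there are `U i` users that are connected to exactly these caches and that
request a file of level `i`. -/
structure CachingSystem (L : ℕ) where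
  K : ℕ
  N : Fin L → ℕ
  U : Fin L → ℕ
  d : Fin L → ℕ
  K_pos : 0 < K
  N_pos : ∀ i, 0 < N i
  U_pos : ∀ i, 0 < U i
  d_pos : ∀ i, 0 < d i
  d_le_K : ∀ i, d i ≤ K

/-- The level-separation factor. -/
def levelSep : ℝ := 1 / 198

/-- The rate `U · min {N / M, K} · (1 - d M / N)` of the single-level scheme with cache memory `M`,
where `N / M` is read as `+∞` for `M = 0`. -/
def singleLevelRate (M K N U d : ℝ) : ℝ :=
  U * (if M = 0 then K else min (N / M) K) * (1 - d * M / N)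

namespace CachingSystem

variable {L : ℕ} (s : CachingSystem L)

/-- The largest access degree. -/
def D : ℕ := Finset.univ.sup s.d

/-- The regularity conditions: every level has at least as many files as users, and the
popularities `U i / N i` of any two different levels are well separated. -/
structure IsRegular : Prop where
  files_ge_users : ∀ i, s.K * s.U i ≤ s.N i
  separated : ∀ i j, i ≠ j → (s.U j : ℝ) / s.N j ≤ (s.U i : ℝ) / s.N i →
    (s.D : ℝ) / levelSep ≤
      Real.sqrt (((s.U i : ℝ) / s.N i) / ((s.U j : ℝ) / s.N j))

/-! ### Placement-and-delivery strategies and achievability -/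

/-- All the files of the server, each of size `F` bits. -/
abbrev Library (F : ℕ) : Type := ∀ i : Fin L, Fin (s.N i) → Fin F → Bool

/-- A combination of user requests. User `u` of level `i` at window `k` requests the file
`r i k u` of level `i`. -/
abbrev Request : Type := ∀ i : Fin L, Fin s.K → Fin (s.U i) → Fin (s.N i)

/-- The `t`-th cache after cache `k`, with cyclic wrap-around. -/
def cacheAt (k : Fin s.K) (t : ℕ) : Fin s.K :=
  ⟨((k : ℕ) + t) % s.K, Nat.mod_lt _ s.K_pos⟩

/-- A strategy for files of `F` bits, with `m` bits of memory in each cache and a broadcast message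
of `b` bits. The cache contents are chosen before the requests are known. The
user `u` of level `i` at window `k` sees the requests, the broadcast message and the contents of
the caches `k, k + 1, …, k + d i - 1`. -/
structure Strategy (F m b : ℕ) where
  place : s.Library F → Fin s.K → Fin m → Bool
  send : s.Request → s.Library F → Fin b → Bool
  decode : ∀ (i : Fin L) (_ : Fin s.K) (_ : Fin (s.U i)),
    s.Request → (Fin b → Bool) → (Fin (s.d i) → Fin m → Bool) → Fin F → Bool

/-- User `u` of level `i` at window `k` recovers the file that it has requested. -/
def Strategy.Recovers {s : CachingSystem L} {F m b : ℕ} (σ : s.Strategy F m b) (r : s.Request)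
    (W : s.Library F) (i : Fin L) (k : Fin s.K) (u : Fin (s.U i)) : Prop :=
  σ.decode i k u r (σ.send r W) (fun t => σ.place W (s.cacheAt k t)) = W i (r i k u)

/-- The probability, for independent and uniformly distributed files, that some user fails to
recover the file that it has requested. -/
def Strategy.errorProb {s : CachingSystem L} {F m b : ℕ} (σ : s.Strategy F m b)
    (r : s.Request) : ℝ :=
  (Nat.card {W : s.Library F // ∃ i k u, ¬ σ.Recovers r W i k u} : ℝ) /
    Nat.card (s.Library F)

/-- Rate `R` is achievable with cache memory `M` (both normalized by the file size): for every
`ε > 0` and every large enough file size `F` there is a strategy with caches of at most `M F` bits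
that serves every combination of requests with a broadcast of at most `(R + ε) F` bits and with
error probability at most `ε`. -/
def Achievable (M R : ℝ) : Prop :=
  ∀ ε : ℝ, 0 < ε → ∃ F₀ : ℕ, ∀ F : ℕ, F₀ ≤ F → ∃ m b : ℕ,
    (m : ℝ) ≤ M * F ∧ (b : ℝ) ≤ (R + ε) * F ∧
      ∃ σ : s.Strategy F m b, ∀ r : s.Request, σ.errorProb r ≤ ε

/-- The single-level subsystem that consists of level `i` alone. -/
def level (i : Fin L) : CachingSystem 1 where
  K := s.K
  N := fun _ => s.N i
  U := fun _ => s.U i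
  d := fun _ => s.d i
  K_pos := s.K_pos
  N_pos := fun _ => s.N_pos i
  U_pos := fun _ => s.U_pos i
  d_pos := fun _ => s.d_pos i
  d_le_K := fun _ => s.d_le_K i

/-! ### Feasible partitions and memory sharing -/

/-- `S_A = ∑_{i ∈ A} √(N_i U_i)`. -/
def S (A : Finset (Fin L)) : ℝ := ∑ i ∈ A, Real.sqrt ((s.N i : ℝ) * s.U i)

/-- `T_A = ∑_{i ∈ A} N_i / d_i`. -/
def T (A : Finset (Fin L)) : ℝ := ∑ i ∈ A, (s.N i : ℝ) / s.d i

/-- `V_A = ∑_{i ∈ A} N_i / K`. -/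
def V (A : Finset (Fin L)) : ℝ := ∑ i ∈ A, (s.N i : ℝ) / s.K

/-- `√(N_i / U_i)`. -/
def q (i : Fin L) : ℝ := Real.sqrt ((s.N i : ℝ) / s.U i)

/-- `M̃ = (M - T_J + V_I) / S_I`, meaningful for nonempty `I`. -/
def Mtilde (M : ℝ) (I J : Finset (Fin L)) : ℝ := (M - s.T J + s.V I) / s.S I

/-- `(H, I, J)` is an `M`-feasible partition of the set of levels. If `I` is empty, then `M̃` is the
quotient of `M - T_J` by zero; it is read as `+∞` and `M - T_J` has to be positive, so that
every level is in `J` and the caches are larger than what storing all levels takes. -/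
structure IsFeasible (M : ℝ) (H I J : Finset (Fin L)) : Prop where
  disjoint_HI : Disjoint H I
  disjoint_HJ : Disjoint H J
  disjoint_IJ : Disjoint I J
  cover : H ∪ I ∪ J = Finset.univ
  of_nonempty : I.Nonempty →
    (∀ h ∈ H, s.Mtilde M I J < 1 / s.K * s.q h) ∧
    (∀ i ∈ I, 1 / s.K * s.q i ≤ s.Mtilde M I J ∧
      s.Mtilde M I J ≤ (1 / s.d i + 1 / s.K) * s.q i) ∧
    (∀ j ∈ J, (1 / s.d j + 1 / s.K) * s.q j < s.Mtilde M I J)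
  of_empty : I = ∅ → H = ∅ ∧ s.T J < M

open Classical in
/-- `I₀ = {i ∈ I : M̃ < (2 / K) √(N_i / U_i)}`. -/
def I₀ (M : ℝ) (I J : Finset (Fin L)) : Finset (Fin L) :=
  I.filter fun i => s.Mtilde M I J < 2 / s.K * s.q i

open Classical in
/-- `I₁ = {i ∈ I : M̃ > (β / d_i + 1 / K) √(N_i / U_i)}`. -/
def I₁ (M : ℝ) (I J : Finset (Fin L)) : Finset (Fin L) :=
  I.filter fun i => (levelSep / s.d i + 1 / s.K) * s.q i < s.Mtilde M I J

/-- `I' = I \ (I₀ ∪ I₁)`. -/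
def I' (M : ℝ) (I J : Finset (Fin L)) : Finset (Fin L) :=
  I \ (s.I₀ M I J ∪ s.I₁ M I J)

/-- The memory `α_i M` that level `i` receives: `N_i / d_i` for `i ∈ J`,
`√(N_i U_i) M̃ - N_i / K` for `i ∈ I`, and `0` for the other levels, those of `H`. -/
def mem (M : ℝ) (I J : Finset (Fin L)) (i : Fin L) : ℝ :=
  if i ∈ J then (s.N i : ℝ) / s.d i
  else if i ∈ I then Real.sqrt ((s.N i : ℝ) * s.U i) * s.Mtilde M I J - (s.N i : ℝ) / s.K
  else 0

/-- The individual rate `R_i(M)` of level `i`: the single-level scheme is applied to level `i`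
with the memory `α_i M`. -/
def rate (M : ℝ) (I J : Finset (Fin L)) (i : Fin L) : ℝ :=
  singleLevelRate (s.mem M I J i) s.K (s.N i) (s.U i) (s.d i)

end CachingSystem

end MultiLevelCaching

end

/-! ### Error-free strategies and how to combine them. -/

noncomputable section

namespace MultiLevelCaching

namespace CachingSystem

variable {L : ℕ} (s : CachingSystem L)

/-! Everything is achieved without errors. Strategies can be juxtaposed, either on disjoint parts of
the files (memory sharing) or on different levels, so it suffices to serve one level with memory μ
at its single-level rate; the whole system then follows by adding memories and rates
(`ExactlyAchievable.of_levels`). For one level with access degree d, put n = K - (d - 1)t. The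
packets are indexed by a rotation and a t-subset T of n points. Stretching each point of T to a
block of d points turns the n points into the K caches, and the packet is stored in the last cache
of each block. A user whose window starts inside a block sees the end of that block; any other user
starts at an unstretched point x, and gets its packet from a sum indexed by T ∪ {x}, whose other
terms it has cached (`solvable_coded`). This gives memory Nt/K and rate U(K - td)/(t + 1). At memory
N/d an MDS code removes the broadcast altogether (`solvable_evaluation`). Interpolating between such
points gives the single-level rate. The rate estimates rest on g = √(NU), q = √(N/U), gq = N:
feasibility says exactly that 0 ≤ μ_i ≤ N_i/d_i on I. Off I₀ at least half of g M̃ survives in μ = g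
M̃ - N/K, which costs the factor 2; the lower bound is Cauchy–Schwarz. Separation forces I₁ to have
at most one level, which therefore receives nearly all of M - T_J. -/

/-- There is an error-free strategy for files, cache contents and broadcasts that are bit strings
indexed by `P`, `Q` and `B`. Decodability is expressed by the requested file being determined by
what the user sees. -/
def Solvable (P Q B : Type) : Prop :=
  ∃ (place : (∀ i : Fin L, Fin (s.N i) → P → Bool) → Fin s.K → Q → Bool)
    (send : s.Request → (∀ i : Fin L, Fin (s.N i) → P → Bool) → B → Bool),
    ∀ r W W' i k u, send r W = send r W' →
      (∀ t < s.d i, place W (s.cacheAt k t) = place W' (s.cacheAt k t)) →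
      W i (r i k u) = W' i (r i k u)

variable {s}

/-- Unused memory and broadcast positions are padded with `false`, so embeddings suffice for them;
the file size must be matched exactly. -/
theorem Solvable.reindex {P Q B P' Q' B' : Type} (h : s.Solvable P Q B) (e : P ≃ P')
    (f : Q ↪ Q') (g : B ↪ B') : s.Solvable P' Q' B' := by
  obtain ⟨place, send, h⟩ := h
  refine ⟨fun W c => Function.extend f (place (fun i n p => W i n (e p)) c) fun _ => false,
    fun r W => Function.extend g (send r fun i n p => W i n (e p)) fun _ => false, ?_⟩
  intro r W W' i k u hs hp
  have key := h r (fun i n p => W i n (e p)) (fun i n p => W' i n (e p)) i k u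
    (by
      funext b
      have := congrFun hs (g b)
      simpa only [g.injective.extend_apply] using this)
    (by
      intro t ht
      funext q
      have := congrFun (hp t ht) (f q)
      simpa only [f.injective.extend_apply] using this)
  funext p
  simpa using congrFun key (e.symm p)

theorem Solvable.sum {P₁ Q₁ B₁ P₂ Q₂ B₂ : Type} (h₁ : s.Solvable P₁ Q₁ B₁)
    (h₂ : s.Solvable P₂ Q₂ B₂) : s.Solvable (P₁ ⊕ P₂) (Q₁ ⊕ Q₂) (B₁ ⊕ B₂) := by
  obtain ⟨place₁, send₁, h₁⟩ := h₁
  obtain ⟨place₂, send₂, h₂⟩ := h₂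
  refine ⟨fun W c => Sum.elim (place₁ (fun i n p => W i n (.inl p)) c)
      (place₂ (fun i n p => W i n (.inr p)) c),
    fun r W => Sum.elim (send₁ r fun i n p => W i n (.inl p))
      (send₂ r fun i n p => W i n (.inr p)), ?_⟩
  intro r W W' i k u hs hp
  have k₁ := h₁ r _ _ i k u (funext fun b => congrFun hs (.inl b))
    (fun t ht => funext fun q => congrFun (hp t ht) (.inl q))
  have k₂ := h₂ r _ _ i k u (funext fun b => congrFun hs (.inr b))
    (fun t ht => funext fun q => congrFun (hp t ht) (.inr q))
  funext p
  cases p with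
  | inl p => exact congrFun k₁ p
  | inr p => exact congrFun k₂ p

variable (s) in
/-- Sending every requested file uncoded. -/
theorem solvable_uncoded (P : Type) :
    s.Solvable P Empty ((Σ i : Fin L, Fin s.K × Fin (s.U i)) × P) := by
  refine ⟨fun _ _ _ => false, fun r W b => W b.1.1 (r b.1.1 b.1.2.1 b.1.2.2) b.2, ?_⟩
  intro r W W' i k u hs _
  funext p
  exact congrFun hs (⟨i, k, u⟩, p)

/-- Serving the levels separately. -/
theorem Solvable.of_levels {P : Type} {Q B : Fin L → Type}
    (h : ∀ i, (s.level i).Solvable P (Q i) (B i)) : s.Solvable P (Σ i, Q i) (Σ i, B i) := by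
  choose place send h using h
  refine ⟨fun W c q => place q.1 (fun _ => W q.1) c q.2,
    fun r W b => send b.1 (fun _ => r b.1) (fun _ => W b.1) b.2, ?_⟩
  intro r W W' i k u hs hp
  exact h i (fun _ => r i) (fun _ => W i) (fun _ => W' i) 0 k u
    (funext fun b => congrFun hs ⟨i, b⟩)
    (fun t ht => funext fun q => congrFun (hp t ht) ⟨i, q⟩)

theorem Solvable.fin {P Q B : Type} [Fintype P] [Fintype Q] [Fintype B] (h : s.Solvable P Q B)
    {F m b : ℕ} (hF : Fintype.card P = F) (hm : Fintype.card Q ≤ m) (hb : Fintype.card B ≤ b) :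
    s.Solvable (Fin F) (Fin m) (Fin b) :=
  h.reindex (Fintype.equivFinOfCardEq hF)
    (Function.Embedding.nonempty_of_card_le (by simpa using hm)).some
    (Function.Embedding.nonempty_of_card_le (by simpa using hb)).some

theorem Solvable.add {F₁ m₁ b₁ F₂ m₂ b₂ : ℕ} (h₁ : s.Solvable (Fin F₁) (Fin m₁) (Fin b₁))
    (h₂ : s.Solvable (Fin F₂) (Fin m₂) (Fin b₂)) :
    s.Solvable (Fin (F₁ + F₂)) (Fin (m₁ + m₂)) (Fin (b₁ + b₂)) :=
  (h₁.sum h₂).fin (by simp) (by simp) (by simp)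

variable (s) in
/-- The total number of users. -/
def users : ℕ := ∑ i, s.K * s.U i

variable (s) in
theorem solvable_fin_uncoded (F : ℕ) : s.Solvable (Fin F) (Fin 0) (Fin (s.users * F)) :=
  (s.solvable_uncoded (Fin F)).fin (by simp) (by simp) (by simp [users])

theorem Solvable.nsmul {F m b : ℕ} (h : s.Solvable (Fin F) (Fin m) (Fin b)) (n : ℕ) :
    s.Solvable (Fin (n * F)) (Fin (n * m)) (Fin (n * b)) := by
  induction n with
  | zero => exact (s.solvable_fin_uncoded 0).fin (by simp) (by simp) (by simp)
  | succ n ih => simpa only [Nat.succ_mul] using ih.add h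

variable (s) in
/-- Achievability without errors, for all file sizes and with a bounded overhead. -/
def ExactlyAchievable (M R : ℝ) : Prop :=
  ∃ C : ℝ, ∀ F : ℕ, ∃ m b : ℕ, (m : ℝ) ≤ M * F ∧ (b : ℝ) ≤ R * F + C ∧
    s.Solvable (Fin F) (Fin m) (Fin b)

theorem Solvable.exists_strategy {F m b : ℕ} (h : s.Solvable (Fin F) (Fin m) (Fin b)) :
    ∃ σ : s.Strategy F m b, ∀ r W i k u, σ.Recovers r W i k u := by
  classical
  obtain ⟨place, send, h⟩ := h
  -- The decoder picks any library consistent with what the user sees; solvability makes the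
  -- requested file independent of this choice.
  refine ⟨⟨place, send, fun i k u r y z =>
    if hW : ∃ W, send r W = y ∧ ∀ t : Fin (s.d i), place W (s.cacheAt k t) = z t
    then hW.choose i (r i k u) else fun _ => false⟩, ?_⟩
  intro r W i k u
  have hW : ∃ W', send r W' = send r W ∧
      ∀ t : Fin (s.d i), place W' (s.cacheAt k t) = place W (s.cacheAt k t) :=
    ⟨W, rfl, fun _ => rfl⟩
  rw [Strategy.Recovers]
  refine (dif_pos hW).trans ?_
  exact h r _ W i k u hW.choose_spec.1 fun t ht => hW.choose_spec.2 ⟨t, ht⟩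

theorem ExactlyAchievable.achievable {M R : ℝ} (h : s.ExactlyAchievable M R) :
    s.Achievable M R := by
  obtain ⟨C, h⟩ := h
  intro ε hε
  obtain ⟨F₀, hF₀⟩ := exists_nat_ge (C / ε)
  refine ⟨F₀, fun F hF => ?_⟩
  obtain ⟨m, b, hm, hb, hsol⟩ := h F
  obtain ⟨σ, hσ⟩ := hsol.exists_strategy
  refine ⟨m, b, hm, ?_, σ, fun r => ?_⟩
  · have h₁ : C / ε ≤ F := hF₀.trans (by exact_mod_cast hF)
    rw [div_le_iff₀ hε] at h₁
    linarith
  · have : IsEmpty {W : s.Library F // ∃ i k u, ¬ σ.Recovers r W i k u} :=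
      ⟨fun ⟨W, i, k, u, hW⟩ => hW (hσ r W i k u)⟩
    simp [Strategy.errorProb, hε.le]

theorem ExactlyAchievable.mono {M R M' R' : ℝ} (h : s.ExactlyAchievable M R) (hM : M ≤ M')
    (hR : R ≤ R') : s.ExactlyAchievable M' R' := by
  obtain ⟨C, h⟩ := h
  refine ⟨C, fun F => ?_⟩
  obtain ⟨m, b, hm, hb, hsol⟩ := h F
  exact ⟨m, b, hm.trans (by gcongr), hb.trans (by gcongr), hsol⟩

/-- A strategy for one file size is repeated; what is left of the files is sent uncoded. -/
theorem Solvable.exactlyAchievable {F₀ m₀ b₀ : ℕ} (h : s.Solvable (Fin F₀) (Fin m₀) (Fin b₀))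
    (hF₀ : 0 < F₀) {M R : ℝ} (hM : m₀ = M * F₀) (hR : b₀ = R * F₀) :
    s.ExactlyAchievable M R := by
  have hF : (0 : ℝ) < F₀ := by exact_mod_cast hF₀
  have hM₀ : 0 ≤ M := nonneg_of_mul_nonneg_left (hM ▸ Nat.cast_nonneg m₀) hF
  have hR₀ : 0 ≤ R := nonneg_of_mul_nonneg_left (hR ▸ Nat.cast_nonneg b₀) hF
  -- Fewer than `F₀` bits of each file are left over. Sending them uncoded takes no memory, so the
  -- memory bound needs no slack.
  refine ⟨s.users * F₀, fun F => ?_⟩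
  have hdm : F / F₀ * F₀ + F % F₀ = F := Nat.div_add_mod' F F₀
  have hle : ((F / F₀ : ℕ) : ℝ) * F₀ ≤ F := by exact_mod_cast Nat.div_mul_le_self F F₀
  refine ⟨F / F₀ * m₀, F / F₀ * b₀ + s.users * (F % F₀), ?_, ?_, ?_⟩
  · push_cast
    rw [hM]
    nlinarith
  · have h₁ : ((F % F₀ : ℕ) : ℝ) ≤ F₀ := by exact_mod_cast (Nat.mod_lt F hF₀).le
    have h₂ : (0 : ℝ) ≤ s.users := Nat.cast_nonneg _
    push_cast
    rw [hR]
    nlinarith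
  · have := (h.nsmul (F / F₀)).add (s.solvable_fin_uncoded (F % F₀))
    rwa [hdm] at this

/-- Memory sharing: the files are split, and different strategies serve the two parts. -/
theorem ExactlyAchievable.convexComb {M₁ R₁ M₂ R₂ a b : ℝ} (h₁ : s.ExactlyAchievable M₁ R₁)
    (h₂ : s.ExactlyAchievable M₂ R₂) (hM₁ : 0 ≤ M₁) (hR₁ : 0 ≤ R₁) (hM₂ : 0 ≤ M₂) (hR₂ : 0 ≤ R₂)
    (ha : 0 ≤ a) (hb : 0 ≤ b) (hab : a + b = 1) :
    s.ExactlyAchievable (a * M₁ + b * M₂) (a * R₁ + b * R₂) := by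
  obtain ⟨C₁, h₁⟩ := h₁
  obtain ⟨C₂, h₂⟩ := h₂
  -- Rounding both parts down leaves at most 2 bits of each file, sent uncoded.
  refine ⟨C₁ + C₂ + s.users * 2, fun F => ?_⟩
  have hF : (0 : ℝ) ≤ F := Nat.cast_nonneg F
  have l₁ := Nat.floor_le (mul_nonneg ha hF)
  have l₂ := Nat.floor_le (mul_nonneg hb hF)
  have g₁ := Nat.lt_floor_add_one (a * F)
  have g₂ := Nat.lt_floor_add_one (b * F)
  have hsum : a * F + b * F = F := by rw [← add_mul, hab, one_mul]
  set F₁ := ⌊a * F⌋₊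
  set F₂ := ⌊b * F⌋₊
  have hle : F₁ + F₂ ≤ F := by
    have : (F₁ : ℝ) + F₂ ≤ F := by linarith
    exact_mod_cast this
  obtain ⟨F₃, hF₃⟩ := Nat.exists_eq_add_of_le hle
  have hcast : (F : ℝ) = F₁ + F₂ + F₃ := by exact_mod_cast hF₃
  have g₃ : (F₃ : ℝ) ≤ 2 := by linarith
  obtain ⟨m₁, b₁, hm₁, hb₁, hsol₁⟩ := h₁ F₁
  obtain ⟨m₂, b₂, hm₂, hb₂, hsol₂⟩ := h₂ F₂
  refine ⟨m₁ + m₂ + 0, b₁ + b₂ + s.users * F₃, ?_, ?_, by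
    rw [hF₃]; exact (hsol₁.add hsol₂).add (s.solvable_fin_uncoded F₃)⟩
  · have e₁ := mul_le_mul_of_nonneg_left l₁ hM₁
    have e₂ := mul_le_mul_of_nonneg_left l₂ hM₂
    calc ((m₁ + m₂ + 0 : ℕ) : ℝ) = m₁ + m₂ := by push_cast; ring
      _ ≤ M₁ * (a * F) + M₂ * (b * F) := by linarith
      _ = _ := by ring
  · have e₁ := mul_le_mul_of_nonneg_left l₁ hR₁
    have e₂ := mul_le_mul_of_nonneg_left l₂ hR₂
    have e₃ := mul_le_mul_of_nonneg_left g₃ (Nat.cast_nonneg (α := ℝ) s.users)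
    calc ((b₁ + b₂ + s.users * F₃ : ℕ) : ℝ) = b₁ + b₂ + s.users * F₃ := by push_cast; ring
      _ ≤ R₁ * (a * F) + R₂ * (b * F) +
          (C₁ + C₂ + s.users * 2) := by linarith
      _ = _ := by ring

theorem ExactlyAchievable.of_levels {M R : Fin L → ℝ}
    (h : ∀ i, (s.level i).ExactlyAchievable (M i) (R i)) :
    s.ExactlyAchievable (∑ i, M i) (∑ i, R i) := by
  choose C h using h
  refine ⟨∑ i, C i, fun F => ?_⟩
  choose m b hm hb hsol using fun i => h i F
  refine ⟨∑ i, m i, ∑ i, b i, ?_, ?_, (Solvable.of_levels hsol).fin (by simp) (by simp) (by simp)⟩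
  · rw [Finset.sum_mul]
    push_cast
    exact Finset.sum_le_sum fun i _ => hm i
  · rw [Finset.sum_mul, ← Finset.sum_add_distrib]
    push_cast
    exact Finset.sum_le_sum fun i _ => hb i

/-! ### A coded caching scheme for multi-access caches -/

/-- The position of `x` after each element of `T` below `x` has been stretched to `e + 1` points. -/
def stretch (e : ℕ) (T : Finset ℕ) (x : ℕ) : ℕ := x + e * (T.filter (· < x)).card

theorem stretch_succ (e : ℕ) (T : Finset ℕ) (x : ℕ) :
    stretch e T (x + 1) = stretch e T x + 1 + if x ∈ T then e else 0 := by
  have : T.filter (· < x + 1) = T.filter (· < x) ∪ T.filter (· = x) := by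
    ext y
    simp only [Finset.mem_filter, Finset.mem_union]
    grind
  rw [stretch, stretch, this, Finset.card_union_of_disjoint, Finset.filter_eq']
  · split_ifs <;> simp <;> ring
  · rw [Finset.disjoint_left]
    intro y
    simp only [Finset.mem_filter]
    grind

/-- The stretched points cover an initial segment of the natural numbers. -/
theorem exists_stretch (e : ℕ) {T : Finset ℕ} {n : ℕ} (hT : T ⊆ Finset.range n) {v : ℕ}
    (hv : v < n + e * T.card) :
    ∃ x < n, stretch e T x ≤ v ∧ v ≤ stretch e T x + if x ∈ T then e else 0 := by
  have hn : v < stretch e T n := by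
    rwa [stretch, Finset.filter_true_of_mem fun x hx => Finset.mem_range.1 (hT hx)]
  have h : ∀ m, v < stretch e T m →
      ∃ x < m, stretch e T x ≤ v ∧ v ≤ stretch e T x + if x ∈ T then e else 0 := by
    intro m
    induction m with
    | zero => simp [stretch]
    | succ m ih =>
      intro hm
      by_cases hvm : v < stretch e T m
      · obtain ⟨x, hx, h⟩ := ih hvm
        exact ⟨x, hx.trans m.lt_succ_self, h⟩
      · rw [stretch_succ] at hm
        exact ⟨m, m.lt_succ_self, by omega, by omega⟩
  exact h n hn

theorem stretch_erase_self (e : ℕ) (S : Finset ℕ) (x : ℕ) :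
    stretch e (S.erase x) x = stretch e S x := by
  rw [stretch, stretch, Finset.filter_erase, Finset.erase_eq_of_notMem (by simp)]

theorem stretch_erase_le (e : ℕ) (S : Finset ℕ) (x y : ℕ) :
    stretch e (S.erase y) x ≤ stretch e S x := by
  rw [stretch, stretch]
  gcongr
  exact Finset.erase_subset _ _

/-- Together with `stretch_erase_le`: removing another point `y` shifts `x` back by at most `e`, so
the old position of `x` stays within the new block of `x`. -/
theorem le_stretch_erase (e : ℕ) (S : Finset ℕ) (x y : ℕ) :
    stretch e S x ≤ stretch e (S.erase y) x + e := by
  rw [stretch, stretch, Finset.filter_erase, add_assoc, ← Nat.mul_succ]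
  gcongr
  have := Finset.pred_card_le_card_erase (s := S.filter (· < x)) (a := y)
  omega

theorem cacheAt_cacheAt {L : ℕ} (s : CachingSystem L) (k : Fin s.K) (a b : ℕ) :
    s.cacheAt (s.cacheAt k a) b = s.cacheAt k (a + b) := by
  simp [cacheAt, add_assoc]

theorem exists_cacheAt_eq {L : ℕ} (s : CachingSystem L) (k c : Fin s.K) :
    ∃ a < s.K, s.cacheAt k a = c := by
  have hk := k.2
  have hc := c.2
  by_cases h : (k : ℕ) ≤ c
  · exact ⟨c - k, by omega, Fin.ext (by
      simp only [cacheAt]; rw [Nat.add_sub_cancel' h, Nat.mod_eq_of_lt hc])⟩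
  · exact ⟨s.K + c - k, by omega, Fin.ext (by
      simp only [cacheAt]
      rw [Nat.add_sub_cancel' (by omega), Nat.add_mod_left, Nat.mod_eq_of_lt hc])⟩

theorem cacheAt_injective {L : ℕ} (s : CachingSystem L) (a : ℕ) :
    Function.Injective fun k => s.cacheAt k a := by
  intro k k' h
  have h' : ((k : ℕ) + a) % s.K = ((k' : ℕ) + a) % s.K := congrArg Fin.val h
  have : (k : ℕ) ≡ k' [MOD s.K] := Nat.ModEq.add_right_cancel' a h'
  exact Fin.ext (by simpa [Nat.ModEq, Nat.mod_eq_of_lt k.2, Nat.mod_eq_of_lt k'.2] using this)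

/-- The coded scheme with `t` copies of each packet. The packets are indexed by a rotation `r` and
a `t`-subset `T` of `range n`; such a packet is stored, for every `x ∈ T`, in the cache that is the
last one of the stretched point `x`, rotated by `r`. -/
theorem solvable_coded (s : CachingSystem 1) {t n : ℕ} (hn : n + (s.d 0 - 1) * t = s.K) :
    s.Solvable (Fin s.K × ((Finset.range n).powersetCard t))
      (Fin (s.N 0) × (Σ T : (Finset.range n).powersetCard t, (T : Finset ℕ)))
      (Fin (s.U 0) × Fin s.K × ((Finset.range n).powersetCard (t + 1))) := by
  set e := s.d 0 - 1
  have hd : e < s.d 0 := Nat.sub_lt (s.d_pos 0) one_pos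
  -- `rot a c` is the rotation that takes position `a` to cache `c`. Thus every cache stores one
  -- rotation for each pair `(T, x)`, and all caches are filled equally.
  have hlast : ∀ a, ∃ g : Fin s.K → Fin s.K, ∀ r, g (s.cacheAt r a) = r := fun a =>
    have : Nonempty (Fin s.K) := ⟨⟨0, s.K_pos⟩⟩
    (s.cacheAt_injective a).hasLeftInverse
  choose rot hrot using hlast
  have herase : ∀ (S : (Finset.range n).powersetCard (t + 1)) (x : (S : Finset ℕ)),
      (S : Finset ℕ).erase x ∈ (Finset.range n).powersetCard t := by
    intro S x
    have hS := Finset.mem_powersetCard.1 S.2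
    exact Finset.mem_powersetCard.2 ⟨(Finset.erase_subset _ _).trans hS.1, by
      rw [Finset.card_erase_of_mem x.2, hS.2, Nat.add_sub_cancel]⟩
  -- Any bijection will do: it only lets bits be added and cancelled.
  let E : Bool ≃ ZMod 2 := Fintype.equivOfCardEq (by simp)
  let user (r : Fin s.K) (S : Finset ℕ) (x : ℕ) : Fin s.K := s.cacheAt r (stretch e S x)
  refine ⟨fun W c q => W 0 q.1 (rot (stretch e q.2.1 q.2.2 + e) c, q.2.1),
    fun req W b => E.symm (∑ x : (b.2.2 : Finset ℕ),
      E (W 0 (req 0 (user b.2.1 b.2.2 x) b.1) (b.2.1, ⟨_, herase b.2.2 x⟩))), ?_⟩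
  intro req W W' i k u hs hp
  obtain rfl : i = 0 := Subsingleton.elim _ _
  -- the packets that the user finds in its caches
  have cached : ∀ (m : Fin (s.N 0)) (r : Fin s.K) (T : (Finset.range n).powersetCard t),
      ∀ x ∈ (T : Finset ℕ), ∀ v, stretch e T x ≤ v → v ≤ stretch e T x + e →
      s.cacheAt r v = k → W 0 m (r, T) = W' 0 m (r, T) := by
    intro m r T x hx v h₁ h₂ hk
    have := congrFun (hp (stretch e T x + e - v) (by omega)) (m, ⟨T, x, hx⟩)
    simp only at this
    rwa [← hk, cacheAt_cacheAt, Nat.add_sub_cancel' h₂, hrot] at this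
  funext ⟨r, T⟩
  obtain ⟨hTn, hTt⟩ := Finset.mem_powersetCard.1 T.2
  -- `v` is the start of the user's window in the coordinates rotated by `r`.
  obtain ⟨v, hvK, hv⟩ := s.exists_cacheAt_eq r k
  obtain ⟨x, hxn, h₁, h₂⟩ := exists_stretch e hTn (v := v) (by rw [hTt, hn]; exact hvK)
  by_cases hx : x ∈ (T : Finset ℕ)
  · exact cached _ r T x hx v h₁ (by simpa [hx] using h₂) hv
  · have hvx : v = stretch e T x := by simp only [hx, if_false] at h₂; omega
    have hST : (insert x (T : Finset ℕ)).erase x = T := Finset.erase_insert hx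
    let S : (Finset.range n).powersetCard (t + 1) := ⟨insert x T, Finset.mem_powersetCard.2
      ⟨Finset.insert_subset (Finset.mem_range.2 hxn) hTn, by
        rw [Finset.card_insert_of_notMem hx, hTt]⟩⟩
    let x₀ : (S : Finset ℕ) := ⟨x, Finset.mem_insert_self x T⟩
    have hSx : stretch e (S : Finset ℕ) x = v := by
      rw [hvx, ← stretch_erase_self e S x]
      exact congrArg (stretch e · x) hST
    have key := E.symm.injective (congrFun hs (u, r, S))
    rw [← Finset.add_sum_erase _ _ (Finset.mem_univ x₀),
      ← Finset.add_sum_erase _ _ (Finset.mem_univ x₀)] at key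
    -- For `y ≠ x` the packet of `S.erase y` has `x` as a stretched point, and `v` lies in its
    -- block: the user has this packet cached, so these terms cancel.
    rw [Finset.sum_congr rfl (g := fun y : (S : Finset ℕ) =>
      E (W' 0 (req 0 (user r S y) u) (r, ⟨_, herase S y⟩)))] at key
    · have := E.injective (add_right_cancel key)
      have hu : user r S x₀ = k := by
        rw [← hv, ← hSx]
      have hT : (⟨_, herase S x₀⟩ : (Finset.range n).powersetCard t) = T := Subtype.ext hST
      simpa only [hu, hT] using this
    · intro y hy
      have hyx : (y : ℕ) ≠ x := fun h => (Finset.mem_erase.1 hy).1 (Subtype.ext h)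
      refine congrArg E (cached _ r ⟨_, herase S y⟩ x
        (Finset.mem_erase.2 ⟨hyx.symm, x₀.2⟩) v ?_ ?_ hv)
      · rw [← hSx]
        exact stretch_erase_le e S x y
      · rw [← hSx]
        exact le_stretch_erase e S x y

/-- Normalizing by the `K * n.choose t` packets per file, the rate is `U` times the ratio of
consecutive binomials, (n - t)/(t + 1), and n - t = K - td. -/
theorem exactlyAchievable_coded (s : CachingSystem 1) {t : ℕ} (ht : t * s.d 0 ≤ s.K) :
    s.ExactlyAchievable (s.N 0 * t / s.K) (s.U 0 * (s.K - t * s.d 0) / (t + 1)) := by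
  obtain ⟨n, hn⟩ : ∃ n, n + (s.d 0 - 1) * t = s.K := by
    have h₁ : (s.d 0 - 1) * t ≤ t * s.d 0 := by
      rw [mul_comm]
      exact Nat.mul_le_mul_left t (Nat.sub_le _ _)
    exact ⟨s.K - (s.d 0 - 1) * t, Nat.sub_add_cancel (h₁.trans ht)⟩
  have htd : (s.d 0 - 1) * t + t = t * s.d 0 := by
    obtain ⟨e, he⟩ := Nat.exists_eq_succ_of_ne_zero (s.d_pos 0).ne'
    rw [he, Nat.succ_sub_one, Nat.succ_eq_add_one]
    ring
  have htn : t ≤ n := by omega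
  have hsol := (s.solvable_coded hn).fin (F := s.K * n.choose t)
    (m := s.N 0 * (n.choose t * t)) (b := s.U 0 * (s.K * n.choose (t + 1)))
    (by simp) (by
      simp only [Fintype.card_prod, Fintype.card_fin, Fintype.card_sigma, Fintype.card_coe]
      gcongr
      rw [Finset.sum_coe_sort ((Finset.range n).powersetCard t) (fun T => T.card),
        Finset.sum_const_nat fun T hT => (Finset.mem_powersetCard.1 hT).2]
      simp) (by simp)
  have hK : (s.K : ℝ) ≠ 0 := by exact_mod_cast s.K_pos.ne'
  refine hsol.exactlyAchievable (mul_pos s.K_pos (Nat.choose_pos htn)) ?_ ?_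
  · push_cast
    field_simp
  · have h₁ : (n.choose (t + 1) : ℝ) * (t + 1) = n.choose t * (n - t) := by
      have := Nat.choose_succ_right_eq n t
      rw [← Nat.cast_sub htn]
      exact_mod_cast this
    have h₂ : (s.K : ℝ) - t * s.d 0 = n - t := by
      have h₃ : ((s.d 0 - 1 : ℕ) : ℝ) * t + t = t * s.d 0 := by exact_mod_cast htd
      have h₄ : (n : ℝ) + ((s.d 0 - 1 : ℕ) : ℝ) * t = s.K := by exact_mod_cast hn
      linarith
    have ht₁ : (t : ℝ) + 1 ≠ 0 := by positivity
    push_cast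
    rw [h₂]
    field_simp
    linear_combination (s.U 0 : ℝ) * h₁

/-! ### MDS-coded caches at memory N/d. -/

/-- Any `d` different evaluations of a polynomial with `d` coefficients determine it. Hence caches
that hold evaluations of the files, seen as polynomials, make a broadcast unnecessary. -/
theorem solvable_evaluation (s : CachingSystem 1) {w : ℕ} (hw : w ≠ 0) (hK : s.K ≤ 2 ^ w) :
    s.Solvable (Fin (s.d 0) × Fin w) (Fin (s.N 0) × Fin w) Empty := by
  have hA : Nat.card (GaloisField 2 w) = 2 ^ w := GaloisField.card 2 w hw
  have : Finite (GaloisField 2 w) := Nat.finite_of_card_ne_zero (by rw [hA]; positivity)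
  have := Fintype.ofFinite (GaloisField 2 w)
  rw [Nat.card_eq_fintype_card] at hA
  let E : (Fin w → Bool) ≃ GaloisField 2 w := Fintype.equivOfCardEq (by simp [hA])
  obtain ⟨x⟩ : Nonempty (Fin s.K ↪ GaloisField 2 w) :=
    Function.Embedding.nonempty_of_card_le (by simpa [hA] using hK)
  refine ⟨fun W c q => E.symm (∑ j : Fin (s.d 0), x c ^ (j : ℕ) * E fun p => W 0 q.1 (j, p)) q.2,
    fun _ _ => Empty.elim, ?_⟩
  intro req W W' i k u _ hp
  obtain rfl : i = 0 := Subsingleton.elim _ _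
  have hinj : Function.Injective fun a : Fin (s.d 0) => x (s.cacheAt k a) := by
    intro a b hab
    have h : ((k : ℕ) + a) % s.K = ((k : ℕ) + b) % s.K := congrArg Fin.val (x.injective hab)
    have h' : (a : ℕ) ≡ b [MOD s.K] := Nat.ModEq.add_left_cancel' (k : ℕ) h
    exact Fin.ext (Nat.ModEq.eq_of_lt_of_lt h' (a.2.trans_le (s.d_le_K 0))
      (b.2.trans_le (s.d_le_K 0)))
  have key := Matrix.eq_zero_of_forall_index_sum_pow_mul_eq_zero hinj
    (v := fun j => E (fun p => W 0 (req 0 k u) (j, p)) - E fun p => W' 0 (req 0 k u) (j, p))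
    (fun a => by
      have h : ∑ j : Fin (s.d 0), x (s.cacheAt k a) ^ (j : ℕ) * E (fun p => W 0 (req 0 k u) (j, p)) =
          ∑ j : Fin (s.d 0), x (s.cacheAt k a) ^ (j : ℕ) * E (fun p => W' 0 (req 0 k u) (j, p)) :=
        E.symm.injective (funext fun p => congrFun (hp a a.2) (req 0 k u, p))
      simp only [mul_sub, Finset.sum_sub_distrib]
      exact sub_eq_zero.2 h)
  funext ⟨j, p⟩
  exact congrFun (E.injective (sub_eq_zero.1 (congrFun key j))) p

theorem exactlyAchievable_evaluation (s : CachingSystem 1) :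
    s.ExactlyAchievable (s.N 0 / s.d 0) 0 := by
  -- Coefficients of w = K bits suffice, as 2 ^ K ≥ K gives each cache its own evaluation point.
  have hsol := (s.solvable_evaluation s.K_pos.ne' Nat.lt_two_pow_self.le).fin
    (F := s.d 0 * s.K) (m := s.N 0 * s.K) (b := 0) (by simp) (by simp) (by simp)
  have hd : (s.d 0 : ℝ) ≠ 0 := by exact_mod_cast (s.d_pos 0).ne'
  refine hsol.exactlyAchievable (mul_pos (s.d_pos 0) s.K_pos) ?_ (by simp)
  push_cast
  field_simp

/-! ### Interpolation to the single-level rate. -/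

/-- The single-level scheme. -/
theorem exactlyAchievable_singleLevelRate (s : CachingSystem 1) {μ : ℝ} (hμ₀ : 0 ≤ μ)
    (hμ : μ ≤ s.N 0 / s.d 0) :
    s.ExactlyAchievable μ (singleLevelRate μ s.K (s.N 0) (s.U 0) (s.d 0)) := by
  have hK : (0 : ℝ) < s.K := by exact_mod_cast s.K_pos
  have hN : (0 : ℝ) < s.N 0 := by exact_mod_cast s.N_pos 0
  have hU : (0 : ℝ) < s.U 0 := by exact_mod_cast s.U_pos 0
  have hd : (0 : ℝ) < s.d 0 := by exact_mod_cast s.d_pos 0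
  -- τ is the possibly fractional number of copies of each packet; the coded scheme covers its
  -- integer values.
  obtain ⟨τ, hτ⟩ : ∃ τ, τ = s.K * μ / s.N 0 := ⟨_, rfl⟩
  have hμτ : μ = s.N 0 * τ / s.K := by rw [hτ]; field_simp
  have hτ₀ : 0 ≤ τ := by rw [hτ]; positivity
  have hτd : τ * s.d 0 ≤ s.K := by
    rw [le_div_iff₀ hd] at hμ
    rw [hτ, div_mul_eq_mul_div, div_le_iff₀ hN, mul_assoc]
    gcongr
  set n := ⌊τ⌋₊
  have hnτ : (n : ℝ) ≤ τ := Nat.floor_le hτ₀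
  have hτn : τ < n + 1 := Nat.lt_floor_add_one τ
  have hnd : n * s.d 0 ≤ s.K := by
    have : (n : ℝ) * s.d 0 ≤ s.K := le_trans (by gcongr) hτd
    exact_mod_cast this
  have lower := s.exactlyAchievable_coded hnd
  -- a second point on the line through the first one
  obtain ⟨v, hτv, hvd, hnv, upper⟩ : ∃ v : ℝ, τ ≤ v ∧ v * s.d 0 ≤ s.K ∧
      (n < v ∨ τ = n) ∧
      s.ExactlyAchievable (s.N 0 * v / s.K) (s.U 0 * (s.K - v * s.d 0) / (n + 1)) := by
    -- The line is v ↦ U(K - vd)/(n + 1). At v = n + 1 the coded scheme is even below it; if that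
    -- point is out of range, v = K/d has rate 0 by the MDS scheme.
    by_cases h : (n + 1) * s.d 0 ≤ s.K
    · have h' : ((n : ℝ) + 1) * s.d 0 ≤ s.K := by exact_mod_cast h
      refine ⟨n + 1, hτn.le, h', .inl (by linarith), ?_⟩
      refine (s.exactlyAchievable_coded h).mono (by push_cast; rfl) ?_
      push_cast
      have : (0 : ℝ) ≤ s.K - (n + 1) * s.d 0 := by linarith
      gcongr
      linarith
    · have hv : τ ≤ s.K / s.d 0 := by rwa [le_div_iff₀ hd]
      refine ⟨s.K / s.d 0, hv, by rw [div_mul_cancel₀ _ hd.ne'], ?_, ?_⟩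
      · rcases hnτ.lt_or_eq with h₁ | h₁
        · exact .inl (h₁.trans_le hv)
        · exact .inr h₁.symm
      · refine s.exactlyAchievable_evaluation.mono (le_of_eq ?_) (le_of_eq ?_)
        · field_simp
        · rw [div_mul_cancel₀ _ hd.ne']
          simp
  -- The interpolated rate is U · K/(n + 1) · (1 - dμ/N), and K/(n + 1) is at most K and at most K/τ
  -- = N/μ.
  have hle : s.U 0 * (s.K - τ * s.d 0) / (n + 1) ≤
      singleLevelRate μ s.K (s.N 0) (s.U 0) (s.d 0) := by
    have h₁ : 1 - s.d 0 * μ / s.N 0 = (s.K - τ * s.d 0) / s.K := by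
      rw [hμτ]
      field_simp
    have h₂ : (0 : ℝ) ≤ s.K - τ * s.d 0 := by linarith
    rw [singleLevelRate, h₁]
    have h₃ : (s.K : ℝ) / (n + 1) ≤ if μ = 0 then (s.K : ℝ) else min (s.N 0 / μ) s.K := by
      have h₄ : (s.K : ℝ) / (n + 1) ≤ s.K := div_le_self hK.le (by linarith [n.cast_nonneg (α := ℝ)])
      split_ifs with h₀
      · exact h₄
      · refine le_min ?_ h₄
        have hμp : 0 < μ := lt_of_le_of_ne hμ₀ (Ne.symm h₀)
        rw [div_le_div_iff₀ (by positivity) hμp]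
        have : s.K * μ = s.N 0 * τ := by rw [hμτ]; field_simp
        rw [this]
        gcongr
    calc s.U 0 * (s.K - τ * s.d 0) / (n + 1)
        = s.U 0 * (s.K / (n + 1)) * ((s.K - τ * s.d 0) / s.K) := by field_simp
      _ ≤ _ := by gcongr
  rcases hnv with hnv | hnv
  · have hpos : 0 < v - n := by linarith
    have hn₀ : (0 : ℝ) ≤ s.K - n * s.d 0 := by
      have : (n : ℝ) * s.d 0 ≤ s.K := by exact_mod_cast hnd
      linarith
    have hv₀ : (0 : ℝ) ≤ s.K - v * s.d 0 := by linarith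
    have hvp : 0 ≤ v := hτ₀.trans hτv
    refine (lower.convexComb upper (a := (v - τ) / (v - n)) (b := (τ - n) / (v - n))
      (by positivity) (by positivity) (by positivity) (by positivity)
      (div_nonneg (by linarith) hpos.le) (div_nonneg (by linarith) hpos.le) ?_).mono
      (le_of_eq ?_) (le_trans (le_of_eq ?_) hle)
    · field_simp
      ring
    · rw [hμτ]
      field_simp
      ring
    · field_simp
      ring
  · refine lower.mono (le_of_eq ?_) (le_trans (le_of_eq ?_) hle)
    · rw [hμτ, hnv]
    · rw [hnv]

end CachingSystem


/-! ### Elementary bounds on the single-level rate. -/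

theorem singleLevelRate_of_pos {M K N U d : ℝ} (hM : 0 < M) (hK : N / M ≤ K) (hN : N ≠ 0) :
    singleLevelRate M K N U d = U * (N / M) - d * U := by
  rw [singleLevelRate, if_neg hM.ne', min_eq_left hK]
  field_simp

theorem singleLevelRate_le_of_pos {M K N U d : ℝ} (hM : 0 < M) (hN : 0 < N) (hU : 0 ≤ U)
    (hd : d * M ≤ N) : singleLevelRate M K N U d ≤ U * (N / M) * (1 - d * M / N) := by
  have : 0 ≤ 1 - d * M / N := by
    rw [sub_nonneg, div_le_one hN]
    exact hd
  rw [singleLevelRate, if_neg hM.ne']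
  gcongr
  exact min_le_left _ _

theorem singleLevelRate_le_mul {M K N U d : ℝ} (hM : 0 ≤ M) (hK : 0 ≤ K) (hN : 0 < N) (hU : 0 ≤ U)
    (hd₀ : 0 ≤ d) (hd : d * M ≤ N) : singleLevelRate M K N U d ≤ U * K := by
  have h₁ : 1 - d * M / N ≤ 1 := by
    have : 0 ≤ d * M / N := by positivity
    linarith
  have h₂ : 0 ≤ 1 - d * M / N := by
    rw [sub_nonneg, div_le_one hN]
    exact hd
  rw [singleLevelRate]
  calc _ ≤ U * K * (1 - d * M / N) := by
        gcongr
        split_ifs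
        · exact le_rfl
        · exact min_le_right _ _
    _ ≤ U * K * 1 := by gcongr
    _ = U * K := mul_one _

/-! ### Memory allocation and the individual and total rates. -/

namespace CachingSystem

variable {L : ℕ} (s : CachingSystem L)

/-- `√(N_i U_i)`. -/
def g (i : Fin L) : ℝ := Real.sqrt ((s.N i : ℝ) * s.U i)

theorem K_pos' : (0 : ℝ) < s.K := by exact_mod_cast s.K_pos

theorem N_pos' (i : Fin L) : (0 : ℝ) < s.N i := by exact_mod_cast s.N_pos i

theorem U_pos' (i : Fin L) : (0 : ℝ) < s.U i := by exact_mod_cast s.U_pos i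

theorem d_pos' (i : Fin L) : (0 : ℝ) < s.d i := by exact_mod_cast s.d_pos i

theorem g_pos (i : Fin L) : 0 < s.g i := Real.sqrt_pos.2 (mul_pos (s.N_pos' i) (s.U_pos' i))

theorem q_pos (i : Fin L) : 0 < s.q i := Real.sqrt_pos.2 (div_pos (s.N_pos' i) (s.U_pos' i))

theorem g_mul_g (i : Fin L) : s.g i * s.g i = s.N i * s.U i :=
  Real.mul_self_sqrt (mul_pos (s.N_pos' i) (s.U_pos' i)).le

theorem q_mul_U (i : Fin L) : s.q i * s.U i = s.g i := by
  rw [q, g, ← Real.sqrt_sq (s.U_pos' i).le, ← Real.sqrt_mul (by positivity),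
    Real.sqrt_sq (s.U_pos' i).le]
  congr 1
  have := (s.U_pos' i).ne'
  field_simp

theorem g_mul_q (i : Fin L) : s.g i * s.q i = s.N i := by
  have h := s.g_mul_g i
  nth_rw 2 [← s.q_mul_U i] at h
  rw [← mul_assoc] at h
  exact mul_right_cancel₀ (s.U_pos' i).ne' h

theorem S_eq (A : Finset (Fin L)) : s.S A = ∑ i ∈ A, s.g i := rfl

theorem S_pos {I : Finset (Fin L)} (hI : I.Nonempty) : 0 < s.S I := Finset.sum_pos (fun i _ => s.g_pos i) hI

variable {s} {M : ℝ} {H I J : Finset (Fin L)}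

theorem mem_of_mem_J {i : Fin L} (hi : i ∈ J) : s.mem M I J i = s.N i / s.d i := if_pos hi

theorem rate_of_mem_J {j : Fin L} (hj : j ∈ J) : s.rate M I J j = 0 := by
  have h₁ := (s.N_pos' j).ne'
  have h₂ := (s.d_pos' j).ne'
  rw [rate, mem_of_mem_J hj, singleLevelRate, mul_div_cancel₀ _ h₂, div_self h₁, sub_self, mul_zero]

theorem div_Mtilde (i : Fin L) :
    2 * s.g i / s.Mtilde M I J = 2 * s.S I * s.g i / (M - s.T J + s.V I) := by
  rw [Mtilde, div_div_eq_mul_div]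
  ring

theorem I₀_subset : s.I₀ M I J ⊆ I := Finset.filter_subset _ _

theorem Mtilde_mul_S (hI : I.Nonempty) : s.Mtilde M I J * s.S I = M - s.T J + s.V I :=
  div_mul_cancel₀ _ (s.S_pos hI).ne'

theorem sum_div_Mtilde :
    ∑ i ∈ I, 2 * s.g i / s.Mtilde M I J = 2 * s.S I ^ 2 / (M - s.T J + s.V I) := by
  rw [Finset.sum_congr rfl fun i _ => div_Mtilde i, ← Finset.sum_div, ← Finset.mul_sum, ← S_eq]
  ring

namespace IsFeasible

variable (hP : s.IsFeasible M H I J)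

include hP

theorem mem_of_mem_I {i : Fin L} (hi : i ∈ I) :
    s.mem M I J i = s.g i * s.Mtilde M I J - s.N i / s.K := by
  rw [mem, if_neg (Finset.disjoint_left.1 hP.disjoint_IJ hi), if_pos hi, g]

theorem mem_of_mem_H {i : Fin L} (hi : i ∈ H) : s.mem M I J i = 0 := by
  rw [mem, if_neg (Finset.disjoint_left.1 hP.disjoint_HJ hi),
    if_neg (Finset.disjoint_left.1 hP.disjoint_HI hi)]

theorem Mtilde_lower {i : Fin L} (hi : i ∈ I) : s.q i / s.K ≤ s.Mtilde M I J := by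
  have := ((hP.of_nonempty ⟨i, hi⟩).2.1 i hi).1
  rwa [one_div_mul_eq_div] at this

theorem Mtilde_upper {i : Fin L} (hi : i ∈ I) :
    s.Mtilde M I J ≤ (1 / s.d i + 1 / s.K) * s.q i :=
  ((hP.of_nonempty ⟨i, hi⟩).2.1 i hi).2

theorem Mtilde_pos {i : Fin L} (hi : i ∈ I) : 0 < s.Mtilde M I J :=
  (div_pos (s.q_pos i) s.K_pos').trans_le (hP.Mtilde_lower hi)

theorem mem_bounds (i : Fin L) : 0 ≤ s.mem M I J i ∧ s.mem M I J i ≤ s.N i / s.d i := by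
  have hN := s.N_pos' i
  have hd := s.d_pos' i
  have hK := s.K_pos'
  have hi : i ∈ H ∪ I ∪ J := by rw [hP.cover]; exact Finset.mem_univ i
  simp only [Finset.mem_union] at hi
  rcases hi with (hi | hi) | hi
  · rw [hP.mem_of_mem_H hi]
    exact ⟨le_rfl, by positivity⟩
  · have h₁ := mul_le_mul_of_nonneg_left (hP.Mtilde_lower hi) (s.g_pos i).le
    have h₂ := mul_le_mul_of_nonneg_left (hP.Mtilde_upper hi) (s.g_pos i).le
    rw [← mul_div_assoc, g_mul_q] at h₁
    have h₃ : s.g i * ((1 / s.d i + 1 / s.K) * s.q i) = s.N i / s.d i + s.N i / s.K := by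
      rw [← g_mul_q]
      ring
    rw [hP.mem_of_mem_I hi]
    constructor <;> linarith
  · rw [mem_of_mem_J hi]
    exact ⟨by positivity, le_rfl⟩

theorem sum_univ (f : Fin L → ℝ) : ∑ i, f i = ∑ i ∈ H, f i + ∑ i ∈ I, f i + ∑ i ∈ J, f i := by
  rw [← hP.cover, Finset.sum_union
    (Finset.disjoint_union_left.2 ⟨hP.disjoint_HJ, hP.disjoint_IJ⟩),
    Finset.sum_union hP.disjoint_HI]

/-- M̃ is the normalization for which S_I M̃ - V_I is the memory left after storing J. -/
theorem sum_mem_I (hI : I.Nonempty) : ∑ i ∈ I, s.mem M I J i = M - s.T J := by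
  rw [Finset.sum_congr rfl fun i hi => hP.mem_of_mem_I hi, Finset.sum_sub_distrib,
    ← Finset.sum_mul, ← S_eq, mul_comm, Mtilde_mul_S hI, V]
  ring

theorem sum_mem_eq : ∑ i, s.mem M I J i = ∑ i ∈ I, s.mem M I J i + s.T J := by
  rw [hP.sum_univ, Finset.sum_congr rfl fun i hi => hP.mem_of_mem_H hi,
    Finset.sum_congr rfl fun i hi => mem_of_mem_J hi, T]
  simp

theorem sum_mem (hI : I.Nonempty) : ∑ i, s.mem M I J i = M := by
  rw [hP.sum_mem_eq, hP.sum_mem_I hI]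
  ring

theorem sum_mem_le : ∑ i, s.mem M I J i ≤ M := by
  rcases I.eq_empty_or_nonempty with hI | hI
  · rw [hP.sum_mem_eq, hI, Finset.sum_empty, zero_add]
    exact (hP.of_empty hI).2.le
  · exact (hP.sum_mem hI).le

theorem d_mul_mem_le (i : Fin L) : s.d i * s.mem M I J i ≤ s.N i := by
  have := (hP.mem_bounds i).2
  rwa [le_div_iff₀ (s.d_pos' i), mul_comm] at this

theorem rate_of_mem_H {h : Fin L} (hh : h ∈ H) : s.rate M I J h = s.K * s.U h := by
  rw [rate, hP.mem_of_mem_H hh, singleLevelRate]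
  simp [mul_comm]

/-- Outside `I₀` at least half of `√(N_i U_i) M̃` is given to level `i`. -/
theorem mem_lower {i : Fin L} (hi : i ∈ I \ s.I₀ M I J) :
    s.N i / s.K ≤ s.mem M I J i ∧ s.g i * s.Mtilde M I J / 2 ≤ s.mem M I J i := by
  obtain ⟨hiI, hi₀⟩ := Finset.mem_sdiff.1 hi
  have h : 2 / s.K * s.q i ≤ s.Mtilde M I J := by
    by_contra h
    exact hi₀ (Finset.mem_filter.2 ⟨hiI, not_le.1 h⟩)
  have h₁ := mul_le_mul_of_nonneg_left h (s.g_pos i).le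
  have h₂ : s.g i * (2 / s.K * s.q i) = 2 * (s.N i / s.K) := by
    rw [← g_mul_q]
    ring
  rw [hP.mem_of_mem_I hiI]
  constructor <;> linarith

theorem mem_pos {i : Fin L} (hi : i ∈ I \ s.I₀ M I J) : 0 < s.mem M I J i :=
  (div_pos (s.N_pos' i) s.K_pos').trans_le (hP.mem_lower hi).1

/-- Memory at least N/K makes N/μ the smaller term of the minimum. -/
theorem rate_eq {i : Fin L} (hi : i ∈ I \ s.I₀ M I J) :
    s.rate M I J i = s.U i * (s.N i / s.mem M I J i) - s.d i * s.U i := by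
  refine singleLevelRate_of_pos (hP.mem_pos hi) ?_ (s.N_pos' i).ne'
  have := (hP.mem_lower hi).1
  rwa [div_le_iff₀ s.K_pos', mul_comm, ← div_le_iff₀ (hP.mem_pos hi)] at this

theorem U_mul_div_mem_le {i : Fin L} (hi : i ∈ I \ s.I₀ M I J) :
    s.U i * (s.N i / s.mem M I J i) ≤ 2 * s.g i / s.Mtilde M I J := by
  have hM := hP.Mtilde_pos (Finset.mem_sdiff.1 hi).1
  have hg := s.g_pos i
  rw [← mul_div_assoc, mul_comm, ← g_mul_g, div_le_div_iff₀ (hP.mem_pos hi) hM]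
  have := mul_le_mul_of_nonneg_left (hP.mem_lower hi).2 hg.le
  linarith

/-- Here the trivial bound KU is good enough, since M̃ < 2q/K and qU = g. -/
theorem rate_le_of_mem_I₀ {i : Fin L} (hi : i ∈ s.I₀ M I J) :
    s.rate M I J i ≤ 2 * s.g i / s.Mtilde M I J := by
  obtain ⟨hiI, hi₀⟩ := Finset.mem_filter.1 hi
  have hK := s.K_pos'
  have hU := s.U_pos' i
  refine (singleLevelRate_le_mul (hP.mem_bounds i).1 hK.le (s.N_pos' i) hU.le (s.d_pos' i).le
    (hP.d_mul_mem_le i)).trans ?_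
  rw [le_div_iff₀ (hP.Mtilde_pos hiI)]
  calc s.U i * s.K * s.Mtilde M I J ≤ s.U i * s.K * (2 / s.K * s.q i) := by gcongr
    _ = 2 * s.g i := by
      rw [← q_mul_U]
      field_simp

theorem rate_le_of_notMem_I₀ {i : Fin L} (hi : i ∈ I \ s.I₀ M I J) :
    s.rate M I J i ≤ 2 * s.g i / s.Mtilde M I J - s.d i * s.U i := by
  rw [hP.rate_eq hi]
  linarith [hP.U_mul_div_mem_le hi]

theorem rate_le_of_mem_I {i : Fin L} (hi : i ∈ I) :
    s.rate M I J i ≤ 2 * s.S I * s.g i / (M - s.T J + s.V I) := by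
  rw [← div_Mtilde]
  by_cases hi₀ : i ∈ s.I₀ M I J
  · exact hP.rate_le_of_mem_I₀ hi₀
  · have := hP.rate_le_of_notMem_I₀ (Finset.mem_sdiff.2 ⟨hi, hi₀⟩)
    linarith [mul_pos (s.d_pos' i) (s.U_pos' i)]

theorem sum_rate : ∑ i, s.rate M I J i = ∑ h ∈ H, (s.K : ℝ) * s.U h + ∑ i ∈ I, s.rate M I J i := by
  rw [hP.sum_univ, Finset.sum_congr rfl fun i hi => hP.rate_of_mem_H hi,
    Finset.sum_congr rfl fun i hi => rate_of_mem_J hi]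
  simp

theorem sum_rate_le : ∑ i, s.rate M I J i ≤
    ∑ h ∈ H, (s.K : ℝ) * s.U h + 2 * s.S I ^ 2 / (M - s.T J + s.V I) -
      ∑ i ∈ I \ s.I₀ M I J, (s.d i : ℝ) * s.U i := by
  rw [hP.sum_rate, ← sum_div_Mtilde, add_sub_assoc,
    ← Finset.sum_sdiff (I₀_subset (s := s) (M := M) (I := I) (J := J)),
    ← Finset.sum_sdiff (I₀_subset (s := s) (M := M) (I := I) (J := J))
      (f := fun i => 2 * s.g i / s.Mtilde M I J)]
  have h₁ := Finset.sum_le_sum fun i hi => hP.rate_le_of_notMem_I₀ (i := i) hi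
  have h₂ := Finset.sum_le_sum fun i hi => hP.rate_le_of_mem_I₀ (i := i) hi
  rw [Finset.sum_sub_distrib] at h₁
  linarith

theorem sum_rate_bounds (hI₀ : s.I₀ M I J = ∅) :
    ∑ h ∈ H, (s.K : ℝ) * s.U h + s.S I ^ 2 / (M - s.T J) - ∑ i ∈ I, (s.d i : ℝ) * s.U i ≤
        ∑ i, s.rate M I J i ∧
      ∑ i, s.rate M I J i ≤
        ∑ h ∈ H, (s.K : ℝ) * s.U h + 2 * s.S I ^ 2 / (M - s.T J) -
          ∑ i ∈ I, (s.d i : ℝ) * s.U i := by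
  have hI' : ∀ i ∈ I, i ∈ I \ s.I₀ M I J := by simp [hI₀]
  constructor
  · have key := Finset.sq_sum_div_le_sum_sq_div I s.g
      (g := fun i => s.mem M I J i) fun i hi => hP.mem_pos (hI' i hi)
    have hsum : ∑ i ∈ I, s.rate M I J i =
        ∑ i ∈ I, s.g i ^ 2 / s.mem M I J i - ∑ i ∈ I, (s.d i : ℝ) * s.U i := by
      rw [← Finset.sum_sub_distrib]
      refine Finset.sum_congr rfl fun i hi => ?_
      rw [hP.rate_eq (hI' i hi), sq, g_mul_g]
      ring
    have hle : s.S I ^ 2 / (M - s.T J) ≤ ∑ i ∈ I, s.g i ^ 2 / s.mem M I J i := by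
      rcases I.eq_empty_or_nonempty with hI | hI
      -- `S ∅ = 0`, so the quotient is 0 whatever its denominator.
      · simp [hI, S]
      · rwa [hP.sum_mem_I hI, ← S_eq] at key
    rw [hP.sum_rate, hsum]
    linarith
  · have h₁ := hP.sum_rate_le
    rw [hI₀, Finset.sdiff_empty] at h₁
    have h₂ : 2 * s.S I ^ 2 / (M - s.T J + s.V I) ≤ 2 * s.S I ^ 2 / (M - s.T J) := by
      rcases I.eq_empty_or_nonempty with hI | hI
      · simp [hI, S]
      · have : 0 < M - s.T J := by
          rw [← hP.sum_mem_I hI]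
          exact Finset.sum_pos (fun i hi => hP.mem_pos (hI' i hi)) hI
        have hV : 0 ≤ s.V I := Finset.sum_nonneg fun i _ => by positivity
        gcongr
        linarith
    linarith

/-! ### The level of I₁. -/

/-- The levels of `I` other than a level of `I₁` are much less popular. -/
theorem separated_of_mem_I₁ (hs : s.IsRegular) {i l : Fin L} (hi : i ∈ s.I₁ M I J) (hl : l ∈ I)
    (hne : i ≠ l) : s.D / levelSep * s.q i ≤ s.q l := by
  have sep : ∀ {a b : Fin L}, a ≠ b → (s.U b : ℝ) / s.N b ≤ (s.U a : ℝ) / s.N a →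
      s.D / levelSep * s.q a ≤ s.q b := by
    intro a b hab h
    have h₁ := hs.separated a b hab h
    have hNa := s.N_pos' a
    have hNb := s.N_pos' b
    have hUa := s.U_pos' a
    have hUb := s.U_pos' b
    have h₂ : ((s.U a : ℝ) / s.N a) / ((s.U b : ℝ) / s.N b) =
        ((s.N b : ℝ) / s.U b) / ((s.N a : ℝ) / s.U a) := by field_simp
    rw [h₂, Real.sqrt_div (by positivity)] at h₁
    exact (le_div_iff₀ (s.q_pos a)).1 h₁
  obtain ⟨hiI, hi₁⟩ := Finset.mem_filter.1 hi
  rcases le_total ((s.U l : ℝ) / s.N l) ((s.U i : ℝ) / s.N i) with h | h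
  · exact sep hne h
  · exfalso
    have h₁ := sep hne.symm h
    have hK := s.K_pos'
    have hdi := s.d_pos' i
    have hq := s.q_pos l
    have hDi : (s.d i : ℝ) ≤ s.D := by exact_mod_cast Finset.le_sup (f := s.d) (Finset.mem_univ i)
    have hD : (1 : ℝ) ≤ s.D := le_trans (by exact_mod_cast s.d_pos i) hDi
    have hdl : (1 : ℝ) / s.d l ≤ 1 := by
      rw [div_le_one (s.d_pos' l)]
      exact_mod_cast s.d_pos l
    have hβ : (0 : ℝ) < levelSep := by norm_num [levelSep]
    have hβ₁ : levelSep ≤ (1 : ℝ) := by norm_num [levelSep]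
    have h₂ := hP.Mtilde_upper hl
    have h₃ : (1 / s.d l + 1 / s.K) * s.q l ≤ (levelSep / s.d i + 1 / s.K) * s.q i := by
      calc (1 / s.d l + 1 / s.K) * s.q l ≤ (1 + 1 / s.K) * s.q l := by gcongr
        _ ≤ (s.D / s.d i + s.D / levelSep / s.K) * s.q l := by
          have e₁ : 1 ≤ (s.D : ℝ) / s.d i := by rwa [one_le_div hdi]
          have e₂ : 1 ≤ (s.D : ℝ) / levelSep := by
            rw [one_le_div hβ]
            exact hβ₁.trans hD
          gcongr
        _ = (levelSep / s.d i + 1 / s.K) * (s.D / levelSep * s.q l) := by field_simp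
        _ ≤ _ := by gcongr
    linarith

theorem erase_subset_of_mem_I₁ (hs : s.IsRegular) {i : Fin L} (hi : i ∈ s.I₁ M I J) :
    I.erase i ⊆ s.I₀ M I J ∪ s.I' M I J := by
  intro l hl
  obtain ⟨hli, hlI⟩ := Finset.mem_erase.1 hl
  have hl₁ : l ∉ s.I₁ M I J := by
    intro hl₁
    -- Two levels of I₁ would each have a q exceeding the other's by the factor D/β > 1.
    have h₁ := hP.separated_of_mem_I₁ hs hi hlI hli.symm
    have h₂ := hP.separated_of_mem_I₁ hs hl₁ (Finset.filter_subset _ _ hi) hli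
    have hD : (1 : ℝ) ≤ s.D := by
      exact_mod_cast (s.d_pos i).trans_le (Finset.le_sup (f := s.d) (Finset.mem_univ i))
    have hβ : (1 : ℝ) < s.D / levelSep := by
      rw [levelSep, lt_div_iff₀ (by norm_num)]
      linarith
    have hi' := s.q_pos i
    have hl' := s.q_pos l
    nlinarith
  rw [I', Finset.mem_union, Finset.mem_sdiff, Finset.mem_union]
  tauto

/-- Since μ_i ≥ βN_i/d_i, the factor N_i/μ_i is at most d_i/β. In 1 - d_iμ_i/N_i, the memory μ_i is
M - T_J minus the shares of the other levels of I, and each such share is at most g_l/g_i in units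
of N_i/d_i. -/
theorem rate_le_of_mem_I₁ (hs : s.IsRegular) {i : Fin L} (hi : i ∈ s.I₁ M I J) :
    s.rate M I J i ≤
      1 / levelSep * s.d i * s.U i * (1 - (M - s.T J) / ((s.N i : ℝ) / s.d i)) +
        1 / levelSep * s.d i * s.U i *
          ((s.S (s.I₀ M I J) + s.S (s.I' M I J)) / s.g i) := by
  have hβ : (0 : ℝ) < levelSep := by norm_num [levelSep]
  have hβ₁ : (1 : ℝ) ≤ s.D / levelSep := by
    have hD : (1 : ℝ) ≤ s.D := by
      exact_mod_cast (s.d_pos i).trans_le (Finset.le_sup (f := s.d) (Finset.mem_univ i))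
    rw [levelSep, le_div_iff₀ (by norm_num)]
    linarith
  obtain ⟨hiI, hi₁⟩ := Finset.mem_filter.1 hi
  have hK := s.K_pos'
  have hN := s.N_pos' i
  have hU := s.U_pos' i
  have hd := s.d_pos' i
  have hg := s.g_pos i
  have hq := s.q_pos i
  have hmem : levelSep * s.N i / s.d i ≤ s.mem M I J i := by
    rw [hP.mem_of_mem_I hiI]
    have h₁ := mul_le_mul_of_nonneg_left hi₁.le hg.le
    have h₂ : s.g i * ((levelSep / s.d i + 1 / s.K) * s.q i) =
        levelSep * s.N i / s.d i + s.N i / s.K := by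
      rw [← g_mul_q]
      ring
    linarith
  have hpos : 0 < s.mem M I J i := lt_of_lt_of_le (by positivity) hmem
  have h₁ : s.rate M I J i ≤
      1 / levelSep * s.d i * s.U i * (1 - s.d i * s.mem M I J i / s.N i) := by
    have h₀ : 0 ≤ 1 - s.d i * s.mem M I J i / s.N i := by
      rw [sub_nonneg, div_le_one hN]
      exact hP.d_mul_mem_le i
    refine (singleLevelRate_le_of_pos hpos hN hU.le (hP.d_mul_mem_le i)).trans ?_
    have h₂ : (s.N i : ℝ) / s.mem M I J i ≤ 1 / levelSep * s.d i := by
      rw [div_le_iff₀ hpos]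
      calc (s.N i : ℝ) = 1 / levelSep * s.d i * (levelSep * s.N i / s.d i) := by field_simp
        _ ≤ _ := by gcongr
    calc (s.U i : ℝ) * (s.N i / s.mem M I J i) * (1 - s.d i * s.mem M I J i / s.N i)
        ≤ s.U i * (1 / levelSep * s.d i) * (1 - s.d i * s.mem M I J i / s.N i) := by gcongr
      _ = _ := by ring
  -- the memory of the other levels of `I`
  have h₂ : ∀ l ∈ I.erase i, s.mem M I J l / (s.N i / s.d i) ≤ s.g l / s.g i := by
    intro l hl
    obtain ⟨hli, hlI⟩ := Finset.mem_erase.1 hl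
    have hgl := s.g_pos l
    have hql : s.q i ≤ s.q l := by
      refine le_trans ?_ (hP.separated_of_mem_I₁ hs hi hlI hli.symm)
      exact le_mul_of_one_le_left hq.le hβ₁
    have h₃ := mul_le_mul_of_nonneg_left (hP.Mtilde_upper hiI) hgl.le
    have h₄ : s.mem M I J l ≤ s.g l * s.q i / s.d i := by
      rw [hP.mem_of_mem_I hlI, ← g_mul_q]
      -- The subtracted N_l/K = g_l q_l/K absorbs the 1/K term of the upper limit for M̃, because
      -- q_i ≤ q_l.
      have h₅ : s.g l * s.q i / s.K ≤ s.g l * s.q l / s.K := by gcongr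
      have h₆ : s.g l * ((1 / s.d i + 1 / s.K) * s.q i) =
          s.g l * s.q i / s.d i + s.g l * s.q i / s.K := by ring
      linarith
    rw [div_le_iff₀ (by positivity), ← g_mul_q]
    refine h₄.trans (le_of_eq ?_)
    field_simp
  have h₃ : (M - s.T J) / (s.N i / s.d i) ≤ s.d i * s.mem M I J i / s.N i +
      (s.S (s.I₀ M I J) + s.S (s.I' M I J)) / s.g i := by
    have hdisj : Disjoint (s.I₀ M I J) (s.I' M I J) :=
      Finset.disjoint_sdiff.mono_left Finset.subset_union_left
    have hS : s.S (I.erase i) ≤ s.S (s.I₀ M I J) + s.S (s.I' M I J) := by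
      rw [S_eq, S_eq, S_eq, ← Finset.sum_union hdisj]
      exact Finset.sum_le_sum_of_subset_of_nonneg (hP.erase_subset_of_mem_I₁ hs hi)
        fun l _ _ => (s.g_pos l).le
    rw [← hP.sum_mem_I ⟨i, hiI⟩, ← Finset.add_sum_erase I _ hiI, add_div]
    refine add_le_add (le_of_eq (by field_simp)) ?_
    calc _ = ∑ l ∈ I.erase i, s.mem M I J l / (s.N i / s.d i) := Finset.sum_div _ _ _
      _ ≤ ∑ l ∈ I.erase i, s.g l / s.g i := Finset.sum_le_sum h₂
      _ = s.S (I.erase i) / s.g i := (Finset.sum_div _ _ _).symm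
      _ ≤ _ := by gcongr
  rw [← mul_add]
  refine h₁.trans ?_
  gcongr
  linarith

theorem exactlyAchievable_level (i : Fin L) :
    (s.level i).ExactlyAchievable (s.mem M I J i) (s.rate M I J i) :=
  (s.level i).exactlyAchievable_singleLevelRate (hP.mem_bounds i).1 (hP.mem_bounds i).2

end IsFeasible

end CachingSystem

end MultiLevelCaching

end

theorem mainTheorem4 {L : ℕ} (s : MultiLevelCaching.CachingSystem L) (hs : s.IsRegular)
    (M : ℝ) (hM : 0 ≤ M) (H I J : Finset (Fin L)) (hP : s.IsFeasible M H I J) :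
    -- the memory is shared among the levels
    (∀ i, 0 ≤ s.mem M I J i ∧ s.mem M I J i ≤ (s.N i : ℝ) / s.d i) ∧
    (∑ i, s.mem M I J i ≤ M) ∧
    (I.Nonempty → ∑ i, s.mem M I J i = M) ∧
    -- each level, with its share of the memory, achieves its individual rate
    (∀ i, (s.level i).Achievable (s.mem M I J i) (s.rate M I J i)) ∧
    -- the individual rates over the refined partition
    (∀ h ∈ H, s.rate M I J h = s.K * s.U h) ∧
    (∀ i ∈ s.I₀ M I J ∪ s.I' M I J,
      s.rate M I J i ≤
        2 * s.S I * Real.sqrt ((s.N i : ℝ) * s.U i) / (M - s.T J + s.V I)) ∧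
    (∀ i ∈ s.I₁ M I J,
      s.rate M I J i ≤
        1 / MultiLevelCaching.levelSep * s.d i * s.U i *
            (1 - (M - s.T J) / ((s.N i : ℝ) / s.d i)) +
          1 / MultiLevelCaching.levelSep * s.d i * s.U i *
            ((s.S (s.I₀ M I J) + s.S (s.I' M I J)) / Real.sqrt ((s.N i : ℝ) * s.U i))) ∧
    (∀ j ∈ J, s.rate M I J j = 0) ∧
    -- the total rate: an upper bound, and a two-sided estimate when `I₀` is empty
    (∑ i, s.rate M I J i ≤
      ∑ h ∈ H, (s.K : ℝ) * s.U h + 2 * s.S I ^ 2 / (M - s.T J + s.V I) -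
        ∑ i ∈ I \ s.I₀ M I J, (s.d i : ℝ) * s.U i) ∧
    (s.I₀ M I J = ∅ →
      ∑ h ∈ H, (s.K : ℝ) * s.U h + s.S I ^ 2 / (M - s.T J) - ∑ i ∈ I, (s.d i : ℝ) * s.U i ≤
          ∑ i, s.rate M I J i ∧
        ∑ i, s.rate M I J i ≤
          ∑ h ∈ H, (s.K : ℝ) * s.U h + 2 * s.S I ^ 2 / (M - s.T J) -
            ∑ i ∈ I, (s.d i : ℝ) * s.U i) ∧
    -- the total rate is achieved with the total memory
    s.Achievable M (∑ i, s.rate M I J i) := by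
  refine ⟨hP.mem_bounds, hP.sum_mem_le, hP.sum_mem, fun i => (hP.exactlyAchievable_level i).achievable,
    fun h hh => hP.rate_of_mem_H hh, fun i hi => hP.rate_le_of_mem_I ?_,
    fun i hi => hP.rate_le_of_mem_I₁ hs hi,
    fun j hj => MultiLevelCaching.CachingSystem.rate_of_mem_J hj, hP.sum_rate_le,
    hP.sum_rate_bounds, ?_⟩
  · rcases Finset.mem_union.1 hi with hi | hi
    · exact Finset.filter_subset _ _ hi
    · exact Finset.sdiff_subset hi
  -- For empty I part of the memory stays unused, hence the monotonicity in M.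
  · exact ((MultiLevelCaching.CachingSystem.ExactlyAchievable.of_levels
      hP.exactlyAchievable_level).mono hP.sum_mem_le le_rfl).achievable
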